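/- For a positive integer $\ell$, write words of $\mathbb{F}_2^{3\ell}$ as $c=(c_{i,j})$ with $0\le i\le 2$, $0\le j\le \ell-1$, in lexicographic order. A binary cubic code of length $3\ell$ is a linear code $C\subseteq\mathbb{F}_2^{3\ell}$ that is $\ell$-quasi-cyclic, i.e. closed under the shift by $\ell$ positions $(c_{i,j})\mapsto(c_{i-1,j})$, where $i-1$ is taken modulo $3$. Self-duality is with respect to the standard (Euclidean) inner product. Let $A_i$ denote the number of codewords of Hamming weight $i$, and let $W_C(y)=\sum_{i} A_i y^i$ be the weight enumerator. Consider the enumerators $$W_1 = 1+(858+8\alpha)y^{12}+(18678-24\alpha)y^{14}+\cdots,\qquad 0\le\alpha\le 778,$$ $$W_2 = 1+(858+8\alpha)y^{12}+(18166-24\alpha)y^{14}+\cdots,\qquad 14\le\alpha\le 756,$$ $$W_3 = 1+1690\,y^{12}+7990\,y^{14}+\cdots,$$ with $\alpha$ an integer, where $W_1$ is the polynomial of degree $66$, symmetric under $y^i\leftrightarrow y^{66-i}$, whose coefficients at $y^{16},y^{18},\dots,y^{32}$ are $201201-48\alpha$, $1590875+208\alpha$, $9461166+72\alpha$, $42430050-792\alpha$,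 $145396680+192\alpha$, $385144056+1728\alpha$, $794791140-1008\alpha$, $1284483772-2352\alpha$, $1631448819+2016\alpha$, and whose remaining coefficients at $y^i$, $i\le 33$, other than those displayed, are $0$. Let $C$ be a binary cubic self-dual $[66,33,12]$ code (so $\ell=22$). Then: 1. $3\mid A_{14}$; 2. $W_C$ does not begin with the displayed terms of $W_2$ (all terms up to $y^{14}$) for any integer $\alpha$, in particular for no $14\le\alpha\le 756$; 3. $W_C$ does not begin with the displayed terms of $W_3$ (all terms up to $y^{14}$); 4. $W_C=W_1$ for some integer $\alpha$ with $0\le\alpha\le 778$. -/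

import Mathlib

open Polynomial

/-- The Euclidean dual `C^⊥ = {u : (u, v) = 0 for all v ∈ C}` of a linear code `C ⊆ F^ι`. -/
def dualCode {F ι : Type*} [Field F] [Fintype ι] (C : Submodule F (ι → F)) :
    Submodule F (ι → F) where
  carrier := {u | ∀ v ∈ C, ∑ i, u i * v i = 0}
  add_mem' := by
    intro a b ha hb v hv
    simp only [Pi.add_apply, add_mul, Finset.sum_add_distrib, ha v hv, hb v hv, add_zero]
  zero_mem' := by
    intro v _
    simp
  smul_mem' := by
    intro c a ha v hv
    simp only [Pi.smul_apply, smul_eq_mul, mul_assoc, ← Finset.mul_sum, ha v hv, mul_zero]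

/-- A linear code is self-dual if it equals its Euclidean dual. -/
def IsSelfDual {F ι : Type*} [Field F] [Fintype ι] (C : Submodule F (ι → F)) : Prop :=
  C = dualCode C

/-- The minimum Hamming distance between two distinct codewords. -/
noncomputable def minDistance {F ι : Type*} [Field F] [DecidableEq F] [Fintype ι]
    (C : Submodule F (ι → F)) : ℕ :=
  sInf {d | ∃ u ∈ C, ∃ v ∈ C, u ≠ v ∧ hammingDist u v = d}

/-- `C` is an `[n, k, d]` linear code: length `n`, dimension `k`, minimum distance `d`. -/
structure IsLinearCode {F ι : Type*} [Field F] [DecidableEq F] [Fintype ι]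
    (C : Submodule F (ι → F)) (n k d : ℕ) : Prop where
  length : Fintype.card ι = n
  dimension : Module.finrank F C = k
  distance : minDistance C = d

/-- The block shift on words `(c_{i,j})`, `0 ≤ i < m`, `0 ≤ j < ℓ`, of length `m * ℓ`: block `i` of
the result is block `i - 1` of `c`, and block `0` of the result is block `m - 1` of `c`. -/
def blockShift {F : Type*} {m ℓ : ℕ} (c : Fin m × Fin ℓ → F) : Fin m × Fin ℓ → F :=
  fun p => c ((finRotate m).symm p.1, p.2)

/-- A linear code of length `m * ℓ` is `ℓ`-quasi-cyclic if it is closed under the shift by `ℓ`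
positions. -/
def IsQuasiCyclic {F : Type*} [Field F] {m ℓ : ℕ} (C : Submodule F (Fin m × Fin ℓ → F)) : Prop :=
  ∀ c ∈ C, blockShift c ∈ C

/-- A binary cubic code of length `3 * ℓ` is a binary `ℓ`-quasi-cyclic code of that length,
that is, the case `q = 2`, `m = 3`. -/
def IsBinaryCubic {ℓ : ℕ} (C : Submodule (ZMod 2) (Fin 3 × Fin ℓ → ZMod 2)) : Prop :=
  IsQuasiCyclic C

/-- `A_i`, the number of codewords of Hamming weight `i`. -/
noncomputable def weightCount {F ι : Type*} [Field F] [DecidableEq F] [Fintype ι]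
    (C : Submodule F (ι → F)) (i : ℕ) : ℕ :=
  {c : ι → F | c ∈ C ∧ hammingNorm c = i}.ncard

/-- The Hamming weight enumerator `∑_{i=0}^n A_i y^i`. -/
noncomputable def weightEnumerator {F ι : Type*} [Field F] [DecidableEq F] [Fintype ι]
    (C : Submodule F (ι → F)) : ℤ[X] :=
  ∑ i ∈ Finset.range (Fintype.card ι + 1), Polynomial.C (weightCount C i : ℤ) * X ^ i

/-- The coefficients of `y^i`, `i ≤ 33`, of the enumerator `W_1` with parameter `α`. -/
def W₁Coeff (α : ℤ) : ℕ → ℤ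
  | 0 => 1
  | 12 => 858 + 8 * α
  | 14 => 18678 - 24 * α
  | 16 => 201201 - 48 * α
  | 18 => 1590875 + 208 * α
  | 20 => 9461166 + 72 * α
  | 22 => 42430050 - 792 * α
  | 24 => 145396680 + 192 * α
  | 26 => 385144056 + 1728 * α
  | 28 => 794791140 - 1008 * α
  | 30 => 1284483772 - 2352 * α
  | 32 => 1631448819 + 2016 * α
  | _ => 0

/-- `W_1 = 1 + (858 + 8α) y^12 + (18678 - 24α) y^14 + ⋯`, as a complete polynomial of degree `66`;
the coefficients of `y^i` and `y^(66 - i)` agree. -/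
noncomputable def W₁ (α : ℤ) : ℤ[X] :=
  ∑ i ∈ Finset.range 67, Polynomial.C (W₁Coeff α (min i (66 - i))) * X ^ i

/-- The displayed terms `1 + (858 + 8α) y^12 + (18166 - 24α) y^14` of `W_2`. -/
noncomputable def W₂Head (α : ℤ) : ℤ[X] :=
  1 + Polynomial.C (858 + 8 * α) * X ^ 12 + Polynomial.C (18166 - 24 * α) * X ^ 14

/-- The displayed terms `1 + 1690 y^12 + 7990 y^14` of `W_3`. -/
noncomputable def W₃Head : ℤ[X] :=
  1 + Polynomial.C 1690 * X ^ 12 + Polynomial.C 7990 * X ^ 14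

/-- The polynomial `p` begins with `h`: `p = h + (terms of degree > 14)`. -/
def BeginsWith (p h : ℤ[X]) : Prop :=
  ∀ i ≤ 14, p.coeff i = h.coeff i

/-- `W_1` has the expected displayed terms. -/
theorem W₁_beginsWith (α : ℤ) : BeginsWith (W₁ α)
    (1 + Polynomial.C (858 + 8 * α) * X ^ 12 + Polynomial.C (18678 - 24 * α) * X ^ 14) := by
  intro i hi
  have h : (W₁ α).coeff i = W₁Coeff α (min i (66 - i)) := by
    simp only [W₁, Polynomial.finsetSum_coeff, Polynomial.coeff_C_mul_X_pow]
    rw [Finset.sum_ite_eq, if_pos (Finset.mem_range.2 (by omega))]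
  rw [h, Polynomial.coeff_add, Polynomial.coeff_add, Polynomial.coeff_C_mul_X_pow,
    Polynomial.coeff_C_mul_X_pow, Polynomial.coeff_one]
  interval_cases i <;> simp [W₁Coeff]

/-! On a self-dual code, half the weight is additive modulo 2, so the words `u` with `(u, v) =
wt(v)/2` for all codewords `v` form a coset of the code, the shadow. Two shadow vectors differ by a
codeword. The block shift is an isometry preserving the code, hence also its shadow. If a shadow
vector has weight below 6, it and its shift differ by a codeword of weight below 12, so they
coincide. The vector then consists of three equal blocks and its weight is divisible by 3. This
rules out shadow vectors of weights 1 and 5 (`IsBinaryCubic.normCount_shadow_eq_zero`).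

The MacWilliams identities for the code and its shadow both come from
`card_mul_normCount_weightCoset`. By evenness and complementation, the unknowns reduce to `A 12, A
14, …, A 32`. Eight identities for the code and three for the shadow (weights 1, 5, 9) determine all
eleven in terms of the number `b` of shadow vectors of weight 9 (`solve_macWilliams`), giving `W₁
b`. Divisibility by 3 and the upper bound on `b` are read off from `A 14 = 18678 - 24 b ≥ 0`. The
heads of `W₂` and `W₃` contradict the relation between `A 12` and `A 14`. -/

/-- The sign character of `ZMod 2` with values in a commutative ring. -/
def bitSign (R : Type*) [CommRing R] (a : ZMod 2) : R := if a = 0 then 1 else -1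

theorem bitSign_zero (R : Type*) [CommRing R] : bitSign R 0 = 1 := by simp [bitSign]

theorem bitSign_one (R : Type*) [CommRing R] : bitSign R 1 = -1 := by simp [bitSign]

theorem bitSign_add (R : Type*) [CommRing R] (a b : ZMod 2) :
    bitSign R (a + b) = bitSign R a * bitSign R b := by
  have h2 : ∀ a : ZMod 2, a = 0 ∨ a = 1 := by decide
  rcases h2 a with rfl | rfl <;> rcases h2 b with rfl | rfl <;>
    simp [bitSign, CharTwo.add_self_eq_zero]

theorem bitSign_sum (R : Type*) [CommRing R] {ι : Type*} (s : Finset ι) (f : ι → ZMod 2) :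
    bitSign R (∑ i ∈ s, f i) = ∏ i ∈ s, bitSign R (f i) := by
  classical
  induction s using Finset.induction_on with
  | empty => simp [bitSign]
  | insert a s ha ih => rw [Finset.sum_insert ha, Finset.prod_insert ha, bitSign_add, ih]

/-! ### Characters, Krawtchouk polynomials and MacWilliams identities for cosets. -/

section Transform

variable {ι : Type*} [Fintype ι]

/-- The weight-graded Fourier transform of a point of the binary Hamming space. -/
theorem sum_pow_hammingNorm_mul_bitSign {R : Type*} [CommRing R] [DecidableEq ι] (x : R)
    (v : ι → ZMod 2) :
    ∑ u : ι → ZMod 2, x ^ hammingNorm u * bitSign R (∑ i, u i * v i) =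
      (1 - x) ^ hammingNorm v * (1 + x) ^ (Fintype.card ι - hammingNorm v) := by
  have key : ∀ u : ι → ZMod 2, x ^ hammingNorm u * bitSign R (∑ i, u i * v i) =
      ∏ i, (if u i ≠ 0 then x else 1) * bitSign R (u i * v i) := by
    intro u
    rw [Finset.prod_mul_distrib, bitSign_sum, Finset.prod_ite, Finset.prod_const,
      Finset.prod_const_one, mul_one]
    rfl
  have factor : ∀ i, ∑ a : ZMod 2, (if a ≠ 0 then x else 1) * bitSign R (a * v i) =
      if v i ≠ 0 then 1 - x else 1 + x := by
    intro i
    have h2 : ∀ a : ZMod 2, a = 0 ∨ a = 1 := by decide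
    have hs : ∀ f : ZMod 2 → R, ∑ a : ZMod 2, f a = f 0 + f 1 := fun f => Fin.sum_univ_two f
    rw [hs]
    rcases h2 (v i) with h | h <;> simp [h, bitSign, sub_eq_add_neg]
  -- The summand is a product over coordinates, so the sum over all words factors into one two-term
  -- sum per coordinate.
  have := Finset.prod_univ_sum (fun _ : ι => (Finset.univ : Finset (ZMod 2)))
    (fun i a => (if a ≠ 0 then x else 1) * bitSign R (a * v i))
  rw [Fintype.piFinset_univ] at this
  simp_rw [key]
  rw [← this]
  simp_rw [factor]
  rw [Finset.prod_ite, Finset.prod_const, Finset.prod_const]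
  congr 2
  have h := Finset.card_filter_add_card_filter_not (s := (Finset.univ : Finset ι))
    (fun i => v i ≠ 0)
  rw [Finset.card_univ] at h
  simp only [hammingNorm]
  omega

/-- The number of elements of weight `i` in a set of binary words. -/
noncomputable def normCount (S : Set (ι → ZMod 2)) (i : ℕ) : ℕ :=
  {c : ι → ZMod 2 | c ∈ S ∧ hammingNorm c = i}.ncard

theorem sum_comp_hammingNorm {R : Type*} [CommRing R] (S : Set (ι → ZMod 2)) [Fintype S]
    (f : ℕ → R) :
    ∑ u : S, f (hammingNorm (u : ι → ZMod 2)) =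
      ∑ i ∈ Finset.range (Fintype.card ι + 1), (normCount S i : R) * f i := by
  classical
  rw [← Finset.sum_fiberwise_of_maps_to (s := Finset.univ)
    (t := Finset.range (Fintype.card ι + 1)) (g := fun u : S => hammingNorm (u : ι → ZMod 2))
    (fun u _ => Finset.mem_range.2 (Nat.lt_succ_of_le hammingNorm_le_card_fintype))]
  refine Finset.sum_congr rfl fun i _ => ?_
  rw [Finset.sum_congr rfl (g := fun _ => f i)
    (fun u hu => by rw [(Finset.mem_filter.1 hu).2]), Finset.sum_const, nsmul_eq_mul]
  congr 2
  rw [normCount, ← Set.ncard_coe_finset, ← Set.ncard_image_of_injective _ Subtype.val_injective]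
  congr 1
  ext c
  simp [and_comm]

/-- The words whose inner product with every codeword `v` is a prescribed function of the
weight of `v`. -/
def weightCoset (C : Submodule (ZMod 2) (ι → ZMod 2)) (g : ℕ → ZMod 2) : Set (ι → ZMod 2) :=
  {u | ∀ v ∈ C, ∑ i, u i * v i = g (hammingNorm v)}

-- Orthogonality of characters: if `q w = 1` for some codeword `w`, translation by `w` permutes the
-- code and negates the sum.
open Classical in
theorem sum_bitSign_eq_ite (C : Submodule (ZMod 2) (ι → ZMod 2)) [Fintype C]
    (q : (ι → ZMod 2) → ZMod 2) (hq : ∀ u ∈ C, ∀ v ∈ C, q (u + v) = q u + q v) :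
    ∑ v : C, bitSign ℤ (q v) = if ∀ v ∈ C, q v = 0 then (Nat.card C : ℤ) else 0 := by
  split_ifs with h
  · rw [Finset.sum_congr rfl (g := fun _ => (1 : ℤ))
      (fun v _ => by rw [h v v.2, bitSign_zero])]
    simp
  · push Not at h
    obtain ⟨w, hw, hne⟩ := h
    have h1 : q w = 1 := by
      have h2 : ∀ a : ZMod 2, a ≠ 0 → a = 1 := by decide
      exact h2 _ hne
    have := Equiv.sum_comp (Equiv.addRight (⟨w, hw⟩ : C)) (fun v : C => bitSign ℤ (q v))
    simp only [Equiv.coe_addRight, Submodule.coe_add] at this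
    simp_rw [fun v : C => hq v v.2 w hw, bitSign_add, h1, bitSign_one] at this
    rw [← Finset.sum_mul] at this
    linarith

/-- The value at `k` of the binary Krawtchouk polynomial of degree `j` and length `n`. -/
noncomputable def krawtchouk (n j k : ℕ) : ℤ :=
  (((1 - X) ^ k * (1 + X) ^ (n - k) : ℤ[X])).coeff j

theorem coeff_comp_neg_X (p : ℤ[X]) (i : ℕ) : (p.comp (-X)).coeff i = (-1) ^ i * p.coeff i := by
  have h : (-X : ℤ[X]) = Polynomial.C (-1) * X := by simp
  rw [h, Polynomial.comp_C_mul_X_coeff, mul_comm]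

theorem krawtchouk_eq_sum (n j k : ℕ) :
    krawtchouk n j k =
      ∑ i ∈ Finset.range (j + 1), (-1) ^ i * (k.choose i : ℤ) * ((n - k).choose (j - i) : ℤ) := by
  have h : ((1 - X) ^ k : ℤ[X]) = ((1 + X) ^ k : ℤ[X]).comp (-X) := by
    simp [sub_eq_add_neg]
  rw [krawtchouk, Polynomial.coeff_mul, Finset.Nat.sum_antidiagonal_eq_sum_range_succ
    (fun a b => ((1 - X) ^ k : ℤ[X]).coeff a * ((1 + X) ^ (n - k) : ℤ[X]).coeff b)]
  refine Finset.sum_congr rfl fun i _ => ?_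
  rw [h, coeff_comp_neg_X, Polynomial.coeff_one_add_X_pow,
    Polynomial.coeff_one_add_X_pow]

/-- Replacing `k` by `n - k` exchanges the two exponents in the generating polynomial, which is the
substitution `X ↦ -X`. -/
theorem krawtchouk_reflect {n k : ℕ} (hk : k ≤ n) (j : ℕ) :
    krawtchouk n j (n - k) = (-1) ^ j * krawtchouk n j k := by
  have h : ((1 - X) ^ (n - k) * (1 + X) ^ (n - (n - k)) : ℤ[X]) =
      ((1 - X) ^ k * (1 + X) ^ (n - k) : ℤ[X]).comp (-X) := by
    rw [Nat.sub_sub_self hk]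
    simp [sub_eq_add_neg, mul_comm]
  rw [krawtchouk, h, coeff_comp_neg_X, krawtchouk]

/-- A MacWilliams identity for the cosets of the dual code cut out by a character that depends
only on the weight. -/
theorem card_mul_normCount_weightCoset (C : Submodule (ZMod 2) (ι → ZMod 2)) (g : ℕ → ZMod 2)
    (hg : ∀ u ∈ C, ∀ v ∈ C,
      g (hammingNorm (u + v)) = g (hammingNorm u) + g (hammingNorm v))
    {j : ℕ} (hj : j ≤ Fintype.card ι) :
    (Nat.card C : ℤ) * normCount (weightCoset C g) j =
      ∑ k ∈ Finset.range (Fintype.card ι + 1),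
        (weightCount C k : ℤ) * (bitSign ℤ (g k) * krawtchouk (Fintype.card ι) j k) := by
  classical
  have h2 : ∀ a b : ZMod 2, a + b = 0 ↔ a = b := by decide
  let q : (ι → ZMod 2) → (ι → ZMod 2) → ZMod 2 := fun u v => ∑ i, u i * v i + g (hammingNorm v)
  have hq : ∀ u, ∀ v ∈ C, ∀ w ∈ C, q u (v + w) = q u v + q u w := by
    intro u v hv w hw
    simp only [q, Pi.add_apply, mul_add, Finset.sum_add_distrib, hg v hv w hw]
    ring
  have hmem : ∀ u, (∀ v ∈ C, q u v = 0) ↔ u ∈ weightCoset C g := by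
    intro u
    simp only [q, weightCoset, Set.mem_ofPred_eq, h2]
  have hpoly : (Polynomial.C (Nat.card C : ℤ)) *
      ∑ u : weightCoset C g, (X : ℤ[X]) ^ hammingNorm (u : ι → ZMod 2) =
      ∑ v : C, Polynomial.C (bitSign ℤ (g (hammingNorm (v : ι → ZMod 2)))) *
        ((1 - X) ^ hammingNorm (v : ι → ZMod 2) *
          (1 + X) ^ (Fintype.card ι - hammingNorm (v : ι → ZMod 2))) := by
    have hsign : ∀ a : ZMod 2, bitSign ℤ[X] a = Polynomial.C (bitSign ℤ a) := by
      intro a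
      simp only [bitSign]
      split_ifs <;> simp
    -- Expand the right side as a double sum over words and codewords. After exchanging the sums,
    -- the inner one is a character sum over `C` that detects membership in the coset.
    simp_rw [← sum_pow_hammingNorm_mul_bitSign, Finset.mul_sum]
    rw [Finset.sum_comm]
    have : ∀ u : ι → ZMod 2, ∑ v : C, Polynomial.C (bitSign ℤ (g (hammingNorm (v : ι → ZMod 2)))) *
        ((X : ℤ[X]) ^ hammingNorm u * bitSign ℤ[X] (∑ i, u i * (v : ι → ZMod 2) i)) =
        if u ∈ weightCoset C g then Polynomial.C (Nat.card C : ℤ) * X ^ hammingNorm u else 0 := by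
      intro u
      have h := sum_bitSign_eq_ite C (q u) (hq u)
      simp only [hmem, q, bitSign_add] at h
      rw [Finset.sum_congr rfl (g := fun v : C => X ^ hammingNorm u * Polynomial.C
        (bitSign ℤ (∑ i, u i * (v : ι → ZMod 2) i) *
          bitSign ℤ (g (hammingNorm (v : ι → ZMod 2)))))
        (fun v _ => by rw [hsign, Polynomial.C_mul]; ring), ← Finset.mul_sum, ← map_sum, h]
      split_ifs <;> simp [mul_comm]
    simp_rw [this]
    rw [← Finset.sum_filter]
    exact (Finset.sum_subtype _ (fun u => Finset.mem_filter_univ u)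
      (fun u => Polynomial.C (Nat.card C : ℤ) * X ^ hammingNorm u)).symm
  rw [sum_comp_hammingNorm (weightCoset C g) (fun i => (X : ℤ[X]) ^ i)] at hpoly
  have hC := sum_comp_hammingNorm (R := ℤ[X]) (C : Set (ι → ZMod 2)) (fun k =>
    Polynomial.C (bitSign ℤ (g k)) * ((1 - X) ^ k * (1 + X) ^ (Fintype.card ι - k)))
  have hc := congrArg (fun p : ℤ[X] => p.coeff j) (hpoly.trans hC)
  simp only [Polynomial.coeff_C_mul, Polynomial.finsetSum_coeff, ← Polynomial.C_eq_natCast,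
    Polynomial.coeff_X_pow] at hc
  simpa [Finset.sum_ite_eq, Nat.lt_succ_of_le hj, normCount, weightCount, krawtchouk] using hc

end Transform

/-! ### Self-dual codes and their shadows. -/

section SelfDual

variable {ι : Type*} [Fintype ι]

theorem binary_eq_zero_or_one (a : ZMod 2) : a = 0 ∨ a = 1 := by
  revert a
  decide

/-- The number of positions at which both words are nonzero. -/
def overlap (u v : ι → ZMod 2) : ℕ := ∑ i, (u i).val * (v i).val

theorem hammingNorm_eq_sum_val (u : ι → ZMod 2) : hammingNorm u = ∑ i, (u i).val := by
  rw [hammingNorm, Finset.card_filter]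
  refine Finset.sum_congr rfl fun i _ => ?_
  rcases binary_eq_zero_or_one (u i) with h | h <;> simp [h, ZMod.val_one]

theorem sum_mul_eq_overlap (u v : ι → ZMod 2) : ∑ i, u i * v i = (overlap u v : ZMod 2) := by
  simp [overlap]

theorem hammingNorm_add_add_overlap (u v : ι → ZMod 2) :
    hammingNorm (u + v) + 2 * overlap u v = hammingNorm u + hammingNorm v := by
  simp only [hammingNorm_eq_sum_val, overlap, Finset.mul_sum, ← Finset.sum_add_distrib,
    Pi.add_apply]
  refine Finset.sum_congr rfl fun i _ => ?_
  generalize u i = a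
  generalize v i = b
  revert a b
  decide

variable {C : Submodule (ZMod 2) (ι → ZMod 2)}

theorem IsSelfDual.mem_iff (hC : IsSelfDual C) {u : ι → ZMod 2} :
    u ∈ C ↔ ∀ v ∈ C, ∑ i, u i * v i = 0 := by
  conv_lhs => rw [hC]
  rfl

theorem IsSelfDual.even_overlap (hC : IsSelfDual C) {u v : ι → ZMod 2} (hu : u ∈ C)
    (hv : v ∈ C) : Even (overlap u v) := by
  rw [← ZMod.natCast_eq_zero_iff_even, ← sum_mul_eq_overlap]
  exact hC.mem_iff.1 hu v hv

theorem overlap_self (u : ι → ZMod 2) : overlap u u = hammingNorm u := by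
  rw [hammingNorm_eq_sum_val, overlap]
  refine Finset.sum_congr rfl fun i _ => ?_
  rcases binary_eq_zero_or_one (u i) with h | h <;> simp [h, ZMod.val_one]

theorem IsSelfDual.even_hammingNorm (hC : IsSelfDual C) {u : ι → ZMod 2} (hu : u ∈ C) :
    Even (hammingNorm u) :=
  overlap_self u ▸ hC.even_overlap hu hu

/-- Since `wt(u + v) = wt u + wt v - 2 |u ∩ v|` and overlaps are even, weights add modulo 4. This
makes the shadow's defining condition a character of `C`. -/
theorem IsSelfDual.half_hammingNorm_add (hC : IsSelfDual C) {u v : ι → ZMod 2} (hu : u ∈ C)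
    (hv : v ∈ C) :
    ((hammingNorm (u + v) / 2 : ℕ) : ZMod 2) =
      ((hammingNorm u / 2 : ℕ) : ZMod 2) + ((hammingNorm v / 2 : ℕ) : ZMod 2) := by
  obtain ⟨a, ha⟩ := hC.even_hammingNorm hu
  obtain ⟨b, hb⟩ := hC.even_hammingNorm hv
  obtain ⟨m, hm⟩ := hC.even_overlap hu hv
  have h := hammingNorm_add_add_overlap u v
  rw [← Nat.cast_add, ZMod.natCast_eq_natCast_iff']
  omega

theorem IsSelfDual.weightCoset_zero (hC : IsSelfDual C) : weightCoset C (fun _ => 0) = C := by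
  ext u
  exact hC.mem_iff.symm

theorem IsSelfDual.one_mem (hC : IsSelfDual C) : (1 : ι → ZMod 2) ∈ C := by
  refine hC.mem_iff.2 fun v hv => ?_
  rw [← hC.mem_iff.1 hv v hv]
  refine Finset.sum_congr rfl fun i _ => ?_
  rcases binary_eq_zero_or_one (v i) with h | h <;> simp [h]

theorem hammingNorm_add_one (u : ι → ZMod 2) :
    hammingNorm (u + 1) = Fintype.card ι - hammingNorm u := by
  have h1 : hammingNorm (1 : ι → ZMod 2) = Fintype.card ι := by
    simp [hammingNorm]
  have h2 : overlap u 1 = hammingNorm u := by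
    simp [hammingNorm_eq_sum_val, overlap, ZMod.val_one]
  have h := hammingNorm_add_add_overlap u 1
  omega

theorem IsSelfDual.weightCount_reflect (hC : IsSelfDual C) {k : ℕ} (hk : k ≤ Fintype.card ι) :
    weightCount C (Fintype.card ι - k) = weightCount C k := by
  rw [weightCount, weightCount,
    ← Set.ncard_image_of_injective {c : ι → ZMod 2 | c ∈ C ∧ hammingNorm c = k}
      (add_left_injective 1)]
  congr 1
  ext c
  constructor
  · rintro ⟨hc, hw⟩
    refine ⟨c + 1, ⟨C.add_mem hc hC.one_mem, ?_⟩, ?_⟩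
    · rw [hammingNorm_add_one, hw]
      omega
    · have : (1 : ι → ZMod 2) + 1 = 0 := by
        funext i
        exact CharTwo.add_self_eq_zero 1
      change c + 1 + 1 = c
      rw [add_assoc, this, add_zero]
  · rintro ⟨u, ⟨hu, hw⟩, rfl⟩
    exact ⟨C.add_mem hu hC.one_mem, by rw [← hw]; exact hammingNorm_add_one u⟩

theorem IsSelfDual.weightCount_odd (hC : IsSelfDual C) {k : ℕ} (hk : Odd k) :
    weightCount C k = 0 := by
  rw [weightCount, Set.ncard_eq_zero, Set.eq_empty_iff_forall_notMem]
  rintro c ⟨hc, hw⟩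
  exact Nat.not_even_iff_odd.2 hk (hw ▸ hC.even_hammingNorm hc)

theorem weightCount_zero (C : Submodule (ZMod 2) (ι → ZMod 2)) : weightCount C 0 = 1 := by
  rw [weightCount, Set.ncard_eq_one]
  refine ⟨0, ?_⟩
  ext c
  simp only [hammingNorm_eq_zero, Set.mem_ofPred_eq, Set.mem_singleton_iff]
  exact ⟨And.right, fun h => ⟨h ▸ C.zero_mem, h⟩⟩

theorem minDistance_le_hammingNorm {u : ι → ZMod 2} (hu : u ∈ C) (h0 : u ≠ 0) :
    minDistance C ≤ hammingNorm u :=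
  Nat.sInf_le ⟨u, hu, 0, C.zero_mem, h0, hammingDist_zero_right u⟩

theorem weightCount_eq_zero_of_lt_minDistance {k : ℕ} (h0 : k ≠ 0) (hk : k < minDistance C) :
    weightCount C k = 0 := by
  rw [weightCount, Set.ncard_eq_zero, Set.eq_empty_iff_forall_notMem]
  rintro c ⟨hc, hw⟩
  have hne : c ≠ 0 := by
    rintro rfl
    simp at hw
    omega
  have := minDistance_le_hammingNorm hc hne
  omega

/-- The shadow of a self-dual code. -/
def shadow (C : Submodule (ZMod 2) (ι → ZMod 2)) : Set (ι → ZMod 2) :=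
  weightCoset C fun k => ((k / 2 : ℕ) : ZMod 2)

/-- The difference is orthogonal to `C`, hence a codeword, and its weight is at most the sum of the
two weights. -/
theorem IsSelfDual.eq_of_mem_shadow (hC : IsSelfDual C) {u w : ι → ZMod 2} (hu : u ∈ shadow C)
    (hw : w ∈ shadow C) (h : hammingNorm u + hammingNorm w < minDistance C) : u = w := by
  by_contra hne
  have hmem : -u + w ∈ C := by
    refine hC.mem_iff.2 fun v hv => ?_
    simp only [Pi.add_apply, Pi.neg_apply, add_mul, neg_mul, Finset.sum_add_distrib,
      Finset.sum_neg_distrib]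
    rw [hu v hv, hw v hv, neg_add_cancel]
  have h1 := minDistance_le_hammingNorm hmem fun h => hne (neg_add_eq_zero.1 h)
  have h2 := hammingDist_triangle u 0 w
  rw [hammingDist_zero_right, hammingDist_zero_left, hammingDist_eq_hammingNorm] at h2
  omega

/-- The MacWilliams identity for a self-dual code, coefficientwise. -/
theorem IsSelfDual.card_mul_weightCount (hC : IsSelfDual C) {j : ℕ} (hj : j ≤ Fintype.card ι) :
    (Nat.card C : ℤ) * weightCount C j =
      ∑ k ∈ Finset.range (Fintype.card ι + 1),
        (weightCount C k : ℤ) * krawtchouk (Fintype.card ι) j k := by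
  have h := card_mul_normCount_weightCoset C (fun _ => 0) (by simp) hj
  rw [hC.weightCoset_zero] at h
  simpa [bitSign_zero, normCount, weightCount] using h

/-- The weight distribution of the shadow in terms of that of the code. -/
theorem IsSelfDual.card_mul_normCount_shadow (hC : IsSelfDual C) {j : ℕ}
    (hj : j ≤ Fintype.card ι) :
    (Nat.card C : ℤ) * normCount (shadow C) j =
      ∑ k ∈ Finset.range (Fintype.card ι + 1), (weightCount C k : ℤ) *
        (bitSign ℤ ((k / 2 : ℕ) : ZMod 2) * krawtchouk (Fintype.card ι) j k) :=
  card_mul_normCount_weightCoset C _ (fun _ hu _ hv => hC.half_hammingNorm_add hu hv) hj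

end SelfDual

/-! ### Block shift and the shadow of a cubic code. -/

section Cubic

variable {ℓ : ℕ}

theorem blockShift_eq_comp {F : Type*} {m : ℕ} (c : Fin m × Fin ℓ → F) :
    blockShift c = c ∘ ((finRotate m).symm.prodCongr (Equiv.refl _)) := rfl

theorem hammingNorm_blockShift {m : ℕ} (c : Fin m × Fin ℓ → ZMod 2) :
    hammingNorm (blockShift c) = hammingNorm c := by
  rw [hammingNorm_eq_sum_val, hammingNorm_eq_sum_val, blockShift_eq_comp]
  exact Equiv.sum_comp ((finRotate m).symm.prodCongr (Equiv.refl _)) fun p => (c p).val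

theorem sum_blockShift_mul_blockShift {m : ℕ} (c d : Fin m × Fin ℓ → ZMod 2) :
    ∑ p, blockShift c p * blockShift d p = ∑ p, c p * d p :=
  Equiv.sum_comp ((finRotate m).symm.prodCongr (Equiv.refl _)) fun p => c p * d p

theorem blockShift_three (c : Fin 3 × Fin ℓ → ZMod 2) :
    blockShift (blockShift (blockShift c)) = c := by
  funext ⟨i, j⟩
  have h : ∀ i : Fin 3, (finRotate 3).symm ((finRotate 3).symm ((finRotate 3).symm i)) = i := by
    decide
  simp only [blockShift, h]

theorem three_dvd_hammingNorm_of_blockShift_eq {c : Fin 3 × Fin ℓ → ZMod 2}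
    (h : blockShift c = c) : 3 ∣ hammingNorm c := by
  have h1 : ∀ j, c (1, j) = c (0, j) := fun j => (congrFun h (1, j)).symm
  have h2 : ∀ j, c (2, j) = c (1, j) := fun j => (congrFun h (2, j)).symm
  rw [hammingNorm_eq_sum_val, Fintype.sum_prod_type, Fin.sum_univ_three]
  simp only [h2, h1]
  exact ⟨∑ j, (c (0, j)).val, by ring⟩

variable {C : Submodule (ZMod 2) (Fin 3 × Fin ℓ → ZMod 2)}

theorem IsBinaryCubic.blockShift_mem_shadow (hC : IsBinaryCubic C)
    {u : Fin 3 × Fin ℓ → ZMod 2} (hu : u ∈ shadow C) : blockShift u ∈ shadow C := by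
  intro v hv
  -- The square of the shift is its inverse, and the inner product is shift-invariant, so `(shift u,
  -- v) = (u, shift² v)`.
  have h := hu (blockShift (blockShift v)) (hC _ (hC _ hv))
  rw [← sum_blockShift_mul_blockShift, blockShift_three] at h
  simpa only [hammingNorm_blockShift] using h

/-- A cubic self-dual code has no shadow vectors of small weight not divisible by three. -/
theorem IsBinaryCubic.normCount_shadow_eq_zero (hC : IsBinaryCubic C) (hd : IsSelfDual C) {i : ℕ}
    (hi : 2 * i < minDistance C) (h3 : ¬ 3 ∣ i) : normCount (shadow C) i = 0 := by
  rw [normCount, Set.ncard_eq_zero, Set.eq_empty_iff_forall_notMem]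
  rintro u ⟨hu, rfl⟩
  refine h3 (three_dvd_hammingNorm_of_blockShift_eq ?_)
  refine hd.eq_of_mem_shadow (hC.blockShift_mem_shadow hu) hu ?_
  rw [hammingNorm_blockShift]
  omega

end Cubic

/-! ### The linear system in length 66. -/

/-- A closed form of `krawtchouk` suited to evaluation. -/
def krawtchoukEval (n j k : ℕ) : ℤ :=
  ∑ i ∈ Finset.range (j + 1), (-1) ^ i * ((k.descFactorial i / i.factorial : ℕ) : ℤ) *
    (((n - k).descFactorial (j - i) / (j - i).factorial : ℕ) : ℤ)

theorem krawtchouk_eq_krawtchoukEval (n j k : ℕ) : krawtchouk n j k = krawtchoukEval n j k := by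
  rw [krawtchouk_eq_sum]
  simp only [krawtchoukEval, Nat.choose_eq_descFactorial_div_factorial]

/-- Odd weights vanish, including the fixed point 33, so folding along `k ↔ 66 - k` leaves twice the
sum over 0 and the even weights 12 to 32. Symmetry of `f` is needed only at even `k`. -/
theorem sum_range_eq_of_symm (A f : ℕ → ℤ) (h0 : A 0 = 1) (hodd : ∀ k, Odd k → A k = 0)
    (hlow : ∀ k, k ≠ 0 → k < 12 → A k = 0) (hA : ∀ k ≤ 66, A (66 - k) = A k)
    (hf : ∀ k ≤ 66, Even k → f (66 - k) = f k) :
    ∑ k ∈ Finset.range 67, A k * f k =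
      2 * (f 0 + ∑ k ∈ Finset.range 11, A (12 + 2 * k) * f (12 + 2 * k)) := by
  have hs : ∀ k ≤ 66, A (66 - k) * f (66 - k) = A k * f k := by
    intro k hk
    rcases Nat.even_or_odd k with h | h
    · rw [hA k hk, hf k hk h]
    · rw [hA k hk, hodd k h, zero_mul, zero_mul]
  have hmid : A 33 = 0 := hodd 33 (by decide)
  have hhalf : ∑ k ∈ Finset.range 33, A k * f k =
      f 0 + ∑ k ∈ Finset.range 11, A (12 + 2 * k) * f (12 + 2 * k) := by
    have ho : ∀ k, A (2 * k + 1) = 0 := fun k => hodd _ ⟨k, rfl⟩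
    have e1 := ho 0; have e3 := ho 1; have e5 := ho 2; have e7 := ho 3; have e9 := ho 4
    have e11 := ho 5; have e13 := ho 6; have e15 := ho 7; have e17 := ho 8; have e19 := ho 9
    have e21 := ho 10; have e23 := ho 11; have e25 := ho 12; have e27 := ho 13
    have e29 := ho 14; have e31 := ho 15
    have z2 := hlow 2 (by decide) (by decide)
    have z4 := hlow 4 (by decide) (by decide)
    have z6 := hlow 6 (by decide) (by decide)
    have z8 := hlow 8 (by decide) (by decide)
    have z10 := hlow 10 (by decide) (by decide)
    norm_num at e1 e3 e5 e7 e9 e11 e13 e15 e17 e19 e21 e23 e25 e27 e29 e31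
    simp only [Finset.sum_range_succ, Finset.sum_range_zero, h0, e1, e3, e5, e7, e9, e11, e13,
      e15, e17, e19, e21, e23, e25, e27, e29, e31, z2, z4, z6, z8, z10]
    ring
  have hsplit := Finset.sum_range_add (fun k => A k * f k) 34 33
  have hrefl := Finset.sum_range_reflect (fun k => A (34 + k) * f (34 + k)) 33
  rw [show 67 = 34 + 33 from rfl, hsplit, Finset.sum_range_succ, hmid, ← hrefl]
  have : ∀ k ∈ Finset.range 33, A (34 + (33 - 1 - k)) * f (34 + (33 - 1 - k)) = A k * f k := by
    intro k hk
    have hk := Finset.mem_range.1 hk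
    rw [show 34 + (33 - 1 - k) = 66 - k by omega]
    exact hs k (by omega)
  rw [Finset.sum_congr rfl this, hhalf]
  ring

theorem bitSign_natCast (R : Type*) [CommRing R] (k : ℕ) :
    bitSign R (k : ZMod 2) = (-1) ^ k := by
  induction k with
  | zero => simp [bitSign_zero]
  | succ k ih => rw [Nat.cast_succ, bitSign_add, ih, bitSign_one, pow_succ]

/-- For even `k`, `(66 - k)/2 = 33 - k/2` and 33 is odd. This sign cancels that of
`krawtchouk_reflect` for odd degree. -/
theorem bitSign_half_reflect {k : ℕ} (hk : k ≤ 66) (he : Even k) :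
    bitSign ℤ (((66 - k) / 2 : ℕ) : ZMod 2) = -bitSign ℤ ((k / 2 : ℕ) : ZMod 2) := by
  obtain ⟨m, rfl⟩ := he
  have h : (((66 - (m + m)) / 2 : ℕ) : ZMod 2) = ((m + m) / 2 : ℕ) + 1 := by
    rw [← Nat.cast_one (R := ZMod 2), ← Nat.cast_add, ZMod.natCast_eq_natCast_iff']
    omega
  rw [h, bitSign_add, bitSign_one, mul_neg_one]

/-- Explicit form of the half sum over the even weights from `12` to `32`. -/
theorem sum_range_eleven (A : ℕ → ℤ) (w : Fin 11 → ℤ) (f : ℕ → ℤ) (hf : ∀ k : Fin 11, f k = w k) :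
    ∑ k ∈ Finset.range 11, A (12 + 2 * k) * f k =
      A 12 * w 0 + A 14 * w 1 + A 16 * w 2 + A 18 * w 3 + A 20 * w 4 + A 22 * w 5 + A 24 * w 6 +
        A 26 * w 7 + A 28 * w 8 + A 30 * w 9 + A 32 * w 10 := by
  rw [Finset.sum_range]
  simp only [hf, Fin.sum_univ_castSucc, Fin.sum_univ_zero, zero_add]
  rfl

/-- The weight distribution in terms of the number `b` of shadow vectors of weight `9`. -/
theorem solve_macWilliams (A : ℕ → ℤ) (b : ℤ)
    (m0 : 2 ^ 33 * 1 = 2 * (1 + (A 12 * 1 + A 14 * 1 + A 16 * 1 + A 18 * 1 + A 20 * 1 + A 22 * 1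
      + A 24 * 1 + A 26 * 1 + A 28 * 1 + A 30 * 1 + A 32 * 1)))
    (m2 : 2 ^ 33 * 0 = 2 * (2145 + (A 12 * 849 + A 14 * 689 + A 16 * 545 + A 18 * 417 +
      A 20 * 305 + A 22 * 209 + A 24 * 129 + A 26 * 65 + A 28 * 17 + A 30 * -15 + A 32 * -31)))
    (m4 : 2 ^ 33 * 0 = 2 * (720720 + (A 12 * 101664 + A 14 * 64064 + A 16 * 37520 + A 18 * 19728
      + A 20 * 8640 + A 22 * 2464 + A 24 * -336 + A 26 * -1040 + A 28 * -672 + A 30 * 0 +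
      A 32 * 464)))
    (m6 : 2 ^ 33 * 0 = 2 * (90858768 + (A 12 * 3959232 + A 14 * 1790880 + A 16 * 669648 +
      A 18 * 166224 + A 20 * -8160 + A 22 * -34496 + A 24 * -14672 + A 26 * 3952 + A 28 * 8064 +
      A 30 * 2016 + A 32 * -4464)))
    (m8 : 2 ^ 33 * 0 = 2 * (5743572120 + (A 12 * 62279208 + A 14 * 16716232 + A 16 * 1890520 +
      A 18 * -993960 + A 20 * -567480 + A 22 * 19624 + A 24 * 143736 + A 26 * 28600 +
      A 28 * -53400 + A 30 * -27000 + A 32 * 31000)))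
    (m10 : 2 ^ 33 * 0 = 2 * (210980549208 + (A 12 * 377103432 + A 14 * 13139880 +
      A 16 * -22936552 + A 18 * -5500008 + A 20 * 2326056 + A 22 * 1245640 + A 24 * -492936 +
      A 26 * -409032 + A 28 * 213256 + A 30 * 208104 + A 32 * -165416)))
    (m12 : 2 ^ 33 * A 12 = 2 * (4922879481520 + (A 12 * 91444864 + A 14 * -392983136 +
      A 16 * -42136080 + A 18 * 36810864 + A 20 * 5225760 + A 22 * -7116032 + A 24 * -380912 +
      A 26 * 2351440 + A 28 * -417088 + A 30 * -1136800 + A 32 * 704816)))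
    (m14 : 2 ^ 33 * A 14 = 2 * (77413632286320 + (A 12 * -6179767776 + A 14 * -399425536 +
      A 16 * 435849520 + A 18 * -365904 + A 20 * -59061120 + A 22 * 13248928 + A 24 * 10514448 +
      A 26 * -8142640 + A 28 * -716832 + A 30 * 4760640 + A 32 * -2459664)))
    (h1 : 2 ^ 33 * 0 = 2 * (66 + (A 12 * 42 + A 14 * -38 + A 16 * 34 + A 18 * -30 + A 20 * 26 +
      A 22 * -22 + A 24 * 18 + A 26 * -14 + A 28 * 10 + A 30 * -6 + A 32 * 2)))
    (h5 : 2 ^ 33 * 0 = 2 * (8936928 + (A 12 * 715680 + A 14 * -387296 + A 16 * 186592 +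
      A 18 * -74016 + A 20 * 18720 + A 22 * 2464 + A 24 * -6048 + A 26 * 2912 + A 28 * 672 +
      A 30 * -2016 + A 32 * 992)))
    (h9 : 2 ^ 33 * b = 2 * (37014131440 + (A 12 * 175791152 + A 14 * -28972112 + A 16 * -3521040
      + A 18 * 3754992 + A 20 * -371280 + A 22 * -617936 + A 24 * 189296 + A 26 * 173680 +
      A 28 * -96464 + A 30 * -85840 + A 32 * 71920))) :
    A 12 = 858 + 8 * b ∧ A 14 = 18678 - 24 * b ∧ A 16 = 201201 - 48 * b ∧ A 18 = 1590875 +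
      208 * b ∧ A 20 = 9461166 + 72 * b ∧ A 22 = 42430050 - 792 * b ∧ A 24 = 145396680 + 192 * b
      ∧ A 26 = 385144056 + 1728 * b ∧ A 28 = 794791140 - 1008 * b ∧ A 30 = 1284483772 - 2352 * b
      ∧ A 32 = 1631448819 + 2016 * b := by
  -- Scaling by `2 ^ 34` clears denominators in the solution of the system, so each certificate
  -- below has integer coefficients.
  have cancel : ∀ x y : ℤ, 2 ^ 34 * (x - y) = 0 → x = y := fun x y h =>
    sub_eq_zero.1 ((mul_eq_zero.1 h).resolve_left (by norm_num))
  refine ⟨cancel _ _ ?_, cancel _ _ ?_, cancel _ _ ?_, cancel _ _ ?_, cancel _ _ ?_,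
    cancel _ _ ?_, cancel _ _ ?_, cancel _ _ ?_, cancel _ _ ?_, cancel _ _ ?_, cancel _ _ ?_⟩
  · linear_combination -1664 * h1 - 224 * h5 - 16 * h9 - 858 * m0 - 454 * m2 - 94 * m4 - 53 * m6 -
      1 * m8 - 3 * m10 + 1 * m12
  · linear_combination 21376 * h1 + 1696 * h5 + 48 * h9 - 18678 * m0 - 5674 * m2 - 1749 * m4 -
      318 * m6 - 75 * m8 + 7 * m10 + 1 * m14
  · linear_combination -203008 * h1 - 7872 * h5 + 96 * h9 - 936672 * m0 - 295904 * m2 - 85421 * m4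
      - 21813 * m6 - 4972 * m8 - 940 * m10 - 153 * m12 - 17 * m14
  · linear_combination 1447680 * h1 + 25920 * h5 - 416 * h9 + 932800 * m0 + 892288 * m2 +
      421787 * m4 + 146115 * m6 + 40196 * m8 + 8420 * m10 + 1311 * m12 + 119 * m14
  · linear_combination -7469696 * h1 - 41952 * h5 - 144 * h9 - 34926606 * m0 - 8583314 * m2 -
      2207621 * m4 - 593682 * m6 - 152679 * m8 - 33165 * m10 - 5196 * m12 - 455 * m14
  · linear_combination 28279680 * h1 - 22880 * h5 + 1584 * h9 - 49550850 * m0 + 4726626 * m2 +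
      4067726 * m4 + 1341915 * m6 + 338187 * m8 + 71745 * m10 + 11385 * m12 + 1012 * m14
  · linear_combination -79272960 * h1 + 203520 * h5 - 384 * h9 - 329688480 * m0 - 31765344 * m2 -
      4643204 * m4 - 1381460 * m6 - 375872 * m8 - 77280 * m10 - 12228 * m12 - 1140 * m14
  · linear_combination 163415040 * h1 - 249088 * h5 - 3456 * h9 - 778330080 * m0 - 26364192 * m2 +
      89772 * m4 - 353028 * m6 - 86176 * m8 - 17280 * m10 - 3060 * m12 - 196 * m14
  · linear_combination -240897280 * h1 - 131520 * h5 + 2016 * h9 - 1494301380 * m0 + 22431364 * m2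
      + 13224776 * m4 + 3379170 * m6 + 924614 * m8 + 191730 * m10 + 30414 * m12 + 2756 * m14
  · linear_combination 233502464 * h1 + 571712 * h5 + 4704 * h9 - 2708017884 * m0 - 33027428 * m2
      - 17087774 * m4 - 5154872 * m6 - 1307678 * m8 - 280490 * m10 - 43516 * m12 - 4082 * m14
  · linear_combination -98821632 * h1 - 349312 * h5 - 4032 * h9 - 3195095904 * m0 + 71992032 * m2
      + 6221802 * m4 + 2638026 * m6 + 624456 * m8 + 137256 * m10 + 21042 * m12 + 2002 * m14

theorem eq_W₁Coeff_of_le (A : ℕ → ℤ) (b : ℤ) (h0 : A 0 = 1) (hodd : ∀ k, Odd k → A k = 0)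
    (hlow : ∀ k, k ≠ 0 → k < 12 → A k = 0) (hA :
    A 12 = 858 + 8 * b ∧ A 14 = 18678 - 24 * b ∧ A 16 = 201201 - 48 * b ∧ A 18 = 1590875 +
      208 * b ∧ A 20 = 9461166 + 72 * b ∧ A 22 = 42430050 - 792 * b ∧ A 24 = 145396680 + 192
      * b ∧ A 26 = 385144056 + 1728 * b ∧ A 28 = 794791140 - 1008 * b ∧ A 30 = 1284483772 -
      2352 * b ∧ A 32 = 1631448819 + 2016 * b) :
    ∀ k ≤ 33, A k = W₁Coeff b k := by
  obtain ⟨e12, e14, e16, e18, e20, e22, e24, e26, e28, e30, e32⟩ := hA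
  intro k hk
  by_cases hzero : Odd k ∨ k ≠ 0 ∧ k < 12
  · have hAk : A k = 0 := hzero.elim (hodd k) fun h => hlow k h.1 h.2
    rw [hAk]
    unfold W₁Coeff
    -- Only the default branch, with value 0, is compatible with `hzero`.
    split <;> first | rfl | exact absurd hzero (by decide)
  · have hk' : k % 2 = 0 ∧ (k = 0 ∨ 12 ≤ k) := by
      rw [Nat.odd_iff] at hzero
      omega
    have hcases : k = 0 ∨ k = 12 ∨ k = 14 ∨ k = 16 ∨ k = 18 ∨ k = 20 ∨ k = 22 ∨ k = 24 ∨
        k = 26 ∨ k = 28 ∨ k = 30 ∨ k = 32 := by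
      omega
    rcases hcases with rfl | rfl | rfl | rfl | rfl | rfl | rfl | rfl | rfl | rfl | rfl | rfl
    exacts [h0, e12, e14, e16, e18, e20, e22, e24, e26, e28, e30, e32]

/-- A weight distribution of length `66` with the symmetries of a self-dual code of minimum
distance `12` that satisfies the MacWilliams identities, and whose shadow has no vectors of weights
`1` and `5`, is determined by the number `B 9` of shadow vectors of weight `9`. -/
theorem eq_W₁Coeff_of_macWilliams (A B : ℕ → ℤ) (h0 : A 0 = 1)
    (hodd : ∀ k, Odd k → A k = 0)
    (hlow : ∀ k, k ≠ 0 → k < 12 → A k = 0) (hA : ∀ k ≤ 66, A (66 - k) = A k)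
    (hmac : ∀ j ≤ 66, 2 ^ 33 * A j = ∑ k ∈ Finset.range 67, A k * krawtchouk 66 j k)
    (hshadow : ∀ j ≤ 66, 2 ^ 33 * B j = ∑ k ∈ Finset.range 67,
      A k * (bitSign ℤ ((k / 2 : ℕ) : ZMod 2) * krawtchouk 66 j k))
    (hB1 : B 1 = 0) (hB5 : B 5 = 0) :
    ∀ k ≤ 66, A k = W₁Coeff (B 9) (min k (66 - k)) := by
  suffices hhalf : ∀ k ≤ 33, A k = W₁Coeff (B 9) k by
    intro k hk
    rcases le_total k (66 - k) with h | h
    · rw [min_eq_left h]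
      exact hhalf k (by omega)
    · rw [min_eq_right h, ← hA k hk]
      exact hhalf (66 - k) (by omega)
  have hm : ∀ j ≤ 66, Even j → ∀ (c : ℤ) (w : Fin 11 → ℤ),
      (krawtchoukEval 66 j 0 = c ∧ ∀ k : Fin 11, krawtchoukEval 66 j (12 + 2 * k) = w k) →
      2 ^ 33 * A j = 2 * (c + (A 12 * w 0 + A 14 * w 1 + A 16 * w 2 + A 18 * w 3 + A 20 * w 4 +
        A 22 * w 5 + A 24 * w 6 + A 26 * w 7 + A 28 * w 8 + A 30 * w 9 + A 32 * w 10)) := by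
    rintro j hj he c w ⟨hc, hw⟩
    rw [hmac j hj, sum_range_eq_of_symm A (fun k => krawtchouk 66 j k) h0 hodd hlow hA]
    · simp only [krawtchouk_eq_krawtchoukEval]
      rw [sum_range_eleven A w (fun k => krawtchoukEval 66 j (12 + 2 * k)) hw, hc]
    · intro k hk _
      rw [krawtchouk_reflect hk, he.neg_one_pow, one_mul]
  have hh : ∀ j ≤ 66, Odd j → ∀ (c : ℤ) (w : Fin 11 → ℤ),
      (krawtchoukEval 66 j 0 = c ∧
        ∀ k : Fin 11, (-1) ^ (k : ℕ) * krawtchoukEval 66 j (12 + 2 * k) = w k) →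
      2 ^ 33 * B j = 2 * (c + (A 12 * w 0 + A 14 * w 1 + A 16 * w 2 + A 18 * w 3 + A 20 * w 4 +
        A 22 * w 5 + A 24 * w 6 + A 26 * w 7 + A 28 * w 8 + A 30 * w 9 + A 32 * w 10)) := by
    rintro j hj ho c w ⟨hc, hw⟩
    rw [hshadow j hj, sum_range_eq_of_symm A
      (fun k => bitSign ℤ ((k / 2 : ℕ) : ZMod 2) * krawtchouk 66 j k) h0 hodd hlow hA]
    -- The sign at weight `12 + 2k` is `(-1) ^ (6 + k)`.
    · have hsign : ∀ k, bitSign ℤ (((12 + 2 * k) / 2 : ℕ) : ZMod 2) = (-1) ^ k := by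
        intro k
        rw [bitSign_natCast, show (12 + 2 * k) / 2 = 6 + k by omega, pow_add]
        norm_num
      simp only [hsign, krawtchouk_eq_krawtchoukEval]
      rw [sum_range_eleven A w (fun k => (-1) ^ k * krawtchoukEval 66 j (12 + 2 * k)) hw, hc]
      simp [bitSign_zero]
    · intro k hk he
      rw [krawtchouk_reflect hk, ho.neg_one_pow, bitSign_half_reflect hk he]
      ring
  -- Each list holds Krawtchouk values at weights 12, 14, …, 32, with alternating signs in the
  -- shadow identities `h1`, `h5`, `h9`; the scalar before it is the value at weight 0.
  have m0 := hm 0 (by decide) (by decide) 1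
    ![1, 1, 1, 1, 1, 1, 1, 1, 1, 1, 1]
    (by decide +kernel)
  have m2 := hm 2 (by decide) (by decide) 2145
    ![849, 689, 545, 417, 305, 209, 129, 65, 17, -15, -31]
    (by decide +kernel)
  have m4 := hm 4 (by decide) (by decide) 720720
    ![101664, 64064, 37520, 19728, 8640, 2464, -336, -1040, -672, 0, 464]
    (by decide +kernel)
  have m6 := hm 6 (by decide) (by decide) 90858768
    ![3959232, 1790880, 669648, 166224, -8160, -34496, -14672, 3952, 8064, 2016, -4464]
    (by decide +kernel)
  have m8 := hm 8 (by decide) (by decide) 5743572120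
    ![62279208, 16716232, 1890520, -993960, -567480, 19624, 143736, 28600, -53400, -27000,
      31000]
    (by decide +kernel)
  have m10 := hm 10 (by decide) (by decide) 210980549208
    ![377103432, 13139880, -22936552, -5500008, 2326056, 1245640, -492936, -409032, 213256,
      208104, -165416]
    (by decide +kernel)
  have m12 := hm 12 (by decide) (by decide) 4922879481520
    ![91444864, -392983136, -42136080, 36810864, 5225760, -7116032, -380912, 2351440,
      -417088, -1136800, 704816]
    (by decide +kernel)
  have m14 := hm 14 (by decide) (by decide) 77413632286320
    ![-6179767776, -399425536, 435849520, -365904, -59061120, 13248928, 10514448, -8142640,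
      -716832, 4760640, -2459664]
    (by decide +kernel)
  have h1 := hh 1 (by decide) (by decide) 66
    ![42, -38, 34, -30, 26, -22, 18, -14, 10, -6, 2]
    (by decide +kernel)
  have h5 := hh 5 (by decide) (by decide) 8936928
    ![715680, -387296, 186592, -74016, 18720, 2464, -6048, 2912, 672, -2016, 992]
    (by decide +kernel)
  have h9 := hh 9 (by decide) (by decide) 37014131440
    ![175791152, -28972112, -3521040, 3754992, -371280, -617936, 189296, 173680, -96464,
      -85840, 71920]
    (by decide +kernel)
  rw [h0] at m0
  rw [hlow _ (by decide) (by decide)] at m2 m4 m6 m8 m10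
  rw [hB1] at h1
  rw [hB5] at h5
  simp only [Matrix.cons_val] at m0 m2 m4 m6 m8 m10 m12 m14 h1 h5 h9
  exact eq_W₁Coeff_of_le A (B 9) h0 hodd hlow
    (solve_macWilliams A (B 9) m0 m2 m4 m6 m8 m10 m12 m14 h1 h5 h9)

/-! ### Conclusion for the weight enumerator. -/

theorem coeff_weightEnumerator {ι : Type*} [Fintype ι] (C : Submodule (ZMod 2) (ι → ZMod 2)) {i : ℕ}
    (hi : i ≤ Fintype.card ι) : (weightEnumerator C).coeff i = weightCount C i := by
  simp only [weightEnumerator, Polynomial.finsetSum_coeff, Polynomial.coeff_C_mul_X_pow]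
  rw [Finset.sum_ite_eq, if_pos (Finset.mem_range.2 (by omega))]

theorem mainTheorem4
    (C : Submodule (ZMod 2) (Fin 3 × Fin 22 → ZMod 2))
    (hcubic : IsBinaryCubic C)
    (hdual : IsSelfDual C)
    (hcode : IsLinearCode C 66 33 12) :
    3 ∣ weightCount C 14 ∧
    (∀ α : ℤ, ¬ BeginsWith (weightEnumerator C) (W₂Head α)) ∧
    ¬ BeginsWith (weightEnumerator C) W₃Head ∧
    ∃ α : ℤ, 0 ≤ α ∧ α ≤ 778 ∧ weightEnumerator C = W₁ α := by
  obtain ⟨hlen, hdim, hdist⟩ := hcode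
  have hcard : (Nat.card C : ℤ) = 2 ^ 33 := by
    have h := Module.natCard_eq_pow_finrank (K := ZMod 2) (V := C)
    rw [hdim, Nat.card_zmod] at h
    exact_mod_cast h
  have hW := eq_W₁Coeff_of_macWilliams (fun k => (weightCount C k : ℤ))
    (fun k => (normCount (shadow C) k : ℤ))
    (by simp [weightCount_zero])
    (fun k hk => by simp [hdual.weightCount_odd hk])
    (fun k h0 hk => by simp [weightCount_eq_zero_of_lt_minDistance h0 (hdist ▸ hk)])
    (fun k hk => by
      have h := hdual.weightCount_reflect (k := k) (by omega)
      rw [hlen] at h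
      exact congrArg _ h)
    (fun j hj => by simpa only [hlen, hcard] using hdual.card_mul_weightCount (hlen ▸ hj))
    (fun j hj => by simpa only [hlen, hcard] using hdual.card_mul_normCount_shadow (hlen ▸ hj))
    (by simpa using hcubic.normCount_shadow_eq_zero hdual (by omega) (by decide))
    (by simpa using hcubic.normCount_shadow_eq_zero hdual (by omega) (by decide))
  have hb : (0 : ℤ) ≤ (normCount (shadow C) 9 : ℤ) := Int.natCast_nonneg _
  generalize (normCount (shadow C) 9 : ℤ) = b at hW hb
  have h12 : (weightCount C 12 : ℤ) = 858 + 8 * b := hW 12 (by decide)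
  have h14 : (weightCount C 14 : ℤ) = 18678 - 24 * b := hW 14 (by decide)
  have c12 := coeff_weightEnumerator C (i := 12) (by omega)
  have c14 := coeff_weightEnumerator C (i := 14) (by omega)
  -- Both 18678 and 24 are multiples of 3, and `18678 - 24 b ≥ 0` gives `b ≤ 778`.
  refine ⟨by omega, fun α h => ?_, fun h => ?_, b, hb, by omega, ?_⟩
  -- The coefficient of `y^12` forces `α = b`, and then the constants 18166 and 18678 disagree.
  · have e12 := h 12 (by decide)
    have e14 := h 14 (by decide)
    rw [c12, h12] at e12
    rw [c14, h14] at e14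
    simp only [W₂Head, Polynomial.coeff_add, Polynomial.coeff_C_mul_X_pow,
      Polynomial.coeff_one] at e12 e14
    norm_num at e12 e14
    omega
  -- Here `1690 = 858 + 8 b` forces `b = 104`, so `A 14 = 16182`, not 7990.
  · have e12 := h 12 (by decide)
    have e14 := h 14 (by decide)
    rw [c12, h12] at e12
    rw [c14, h14] at e14
    simp only [W₃Head, Polynomial.coeff_add, Polynomial.coeff_C_mul_X_pow,
      Polynomial.coeff_one] at e12 e14
    norm_num at e12 e14
    omega
  · rw [weightEnumerator, W₁, hlen]
    refine Finset.sum_congr rfl fun k hk => ?_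
    have h : (weightCount C k : ℤ) = _ := hW k (Nat.lt_succ_iff.1 (Finset.mem_range.1 hk))
    rw [h]
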